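/- Let $n\ge 2$ be an integer and let $n-1<p<n$. There exists a constant $C>0$ depending only on $n$ and $p$ with the following property. Let $\Omega\subset\mathbb{R}^n$ be a domain (a nonempty connected open set), and let $f\colon\Omega\to\mathbb{R}^n$ be a continuous map in the Sobolev class $W^{1,p}_{\mathrm{loc}}(\Omega,\mathbb{R}^n)$, with weak differential $Df$. Assume that $f$ is monotone, i.e. every component $f_i$ of $f$ satisfies $\sup_{\partial B}f_i=\sup_B f_i$ and $\inf_{\partial B}f_i=\inf_B f_i$ for every ball $B$ whose closure is contained in $\Omega$. Then for every $x\in\mathbb{R}^n$ and $r>0$ such that the closure of the ball $B(x,2r)$ is contained in $\Omega$, $$ \operatorname{diam} f(B(x,r))\le C\,r^{1-\frac np}\Bigl(\int_{A(x,r,2r)}|Df|^p\Bigr)^{1/p}, $$ where $A(x,r,2r)=\{y\in\mathbb{R}^n : r\le |x-y|\le 2r\}$ is the closed annulus and $|Df|$ is the operator norm of $Df$. -/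

import Mathlib

open MeasureTheory Metric Set
open scoped ENNReal ContDiff

/-- `Df` is a weak differential of the map `f` in the open set `Ω`: both are locally integrable in
`Ω`, and integration by parts holds against every real-valued test function `φ ∈ C_c^∞(Ω)` and in
every direction `v`. -/
structure HasWeakFDerivOn {n : ℕ} (Ω : Set (EuclideanSpace ℝ (Fin n)))
    (f : EuclideanSpace ℝ (Fin n) → EuclideanSpace ℝ (Fin n))
    (Df : EuclideanSpace ℝ (Fin n) → EuclideanSpace ℝ (Fin n) →L[ℝ] EuclideanSpace ℝ (Fin n)) :
    Prop where
  locallyIntegrableOn : LocallyIntegrableOn f Ω volume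
  locallyIntegrableOn_deriv : LocallyIntegrableOn Df Ω volume
  integral_by_parts : ∀ φ : EuclideanSpace ℝ (Fin n) → ℝ, ContDiff ℝ ∞ φ → HasCompactSupport φ →
    tsupport φ ⊆ Ω → ∀ v : EuclideanSpace ℝ (Fin n),
      ∫ y in Ω, (fderiv ℝ φ y v) • f y = - ∫ y in Ω, φ y • Df y v

/-- `f` belongs to the Sobolev class `W^{1,p}_loc(Ω, ℝⁿ)` and `Df` is its weak differential:
`f` and `Df` are in `L^p` on every compact subset of `Ω`. -/
structure IsSobolevLocOn {n : ℕ} (Ω : Set (EuclideanSpace ℝ (Fin n))) (p : ℝ)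
    (f : EuclideanSpace ℝ (Fin n) → EuclideanSpace ℝ (Fin n))
    (Df : EuclideanSpace ℝ (Fin n) → EuclideanSpace ℝ (Fin n) →L[ℝ] EuclideanSpace ℝ (Fin n)) :
    Prop where
  hasWeakFDerivOn : HasWeakFDerivOn Ω f Df
  memLp : ∀ K : Set (EuclideanSpace ℝ (Fin n)), IsCompact K → K ⊆ Ω →
    MemLp f (ENNReal.ofReal p) (volume.restrict K)
  memLp_deriv : ∀ K : Set (EuclideanSpace ℝ (Fin n)), IsCompact K → K ⊆ Ω →
    MemLp Df (ENNReal.ofReal p) (volume.restrict K)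

/-- A real function `u` is monotone in `Ω` (in the sense of Lebesgue): for every ball `B` whose
closure lies in `Ω`, `sup_{∂B} u = sup_B u` and `inf_{∂B} u = inf_B u`. The suprema and infima are
taken in the extended reals, so that they always exist. -/
def IsMonotoneInBalls {n : ℕ} (Ω : Set (EuclideanSpace ℝ (Fin n)))
    (u : EuclideanSpace ℝ (Fin n) → ℝ) : Prop :=
  ∀ (x : EuclideanSpace ℝ (Fin n)) (r : ℝ), 0 < r → closedBall x r ⊆ Ω →
    (⨆ y ∈ sphere x r, (u y : EReal)) = (⨆ y ∈ ball x r, (u y : EReal)) ∧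
    (⨅ y ∈ sphere x r, (u y : EReal)) = (⨅ y ∈ ball x r, (u y : EReal))

/-- The closed annulus `A(x, r, R) = {y : r ≤ |x - y| ≤ R}`. -/
def closedAnnulus {n : ℕ} (x : EuclideanSpace ℝ (Fin n)) (r R : ℝ) :
    Set (EuclideanSpace ℝ (Fin n)) :=
  {y | r ≤ dist x y ∧ dist x y ≤ R}

/-! A monotone map oscillates on every sphere `∂B(x, t)`, `r < t < 2r`, at least as much as on
`B(x, r)`. Since `p > n - 1`, the Sobolev embedding on the `(n - 1)`-dimensional sphere bounds the
oscillation over `∂B(x, t)` by a power of `t` times the `L^p` norm of the differential on that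
sphere; raising this to the power `p` and integrating over `t` gives the energy in the annulus.

The spheres are treated without surface measure. Radial projection of the cube `[-1, 1]ⁿ` divides
a sphere into `2n` faces, each parametrized by `[-1, 1]ⁿ⁻¹` (`spherePoint`). On a face the embedding
is Morrey's estimate on a convex set (`exists_enorm_sub_le_of_segment`), applied along projected
segments; a bound on the faces gives one on the sphere because faces share vertices
(`edist_le_of_face`). Integrating the parameter integrals over the radius returns a volume integral
over the annulus after two linear substitutions (`lintegral_spherePoint_le`), which replace
polar coordinates.

The embedding is applied to mollifications `g` of `f`. These need not be monotone, but they are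
uniformly close to `f`, which preserves the lower bound on the oscillation over spheres up to a small
error, and their energy in a slightly smaller annulus does not exceed that of `f`
(`exists_contDiff_approx`). Hence only radii near `3r / 2` are used, and no convergence of the
energies is needed. -/

/-! ### Morrey's estimate on a convex set -/

theorem lintegral_rpow_le_of_one_le {α : Type*} [MeasurableSpace α] {μ : Measure α}
    {F : α → ℝ≥0∞} {p : ℝ} (hp : 1 ≤ p) (hF : AEMeasurable F μ) :
    ∫⁻ a, F a ∂μ ≤ (∫⁻ a, F a ^ p ∂μ) ^ (1 / p) * μ univ ^ (1 - 1 / p) := by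
  have h := eLpNorm'_le_eLpNorm'_mul_rpow_measure_univ one_pos hp hF.aestronglyMeasurable
  simpa [eLpNorm'] using h

theorem rpow_lintegral_le_of_isProbabilityMeasure {α : Type*} [MeasurableSpace α] {μ : Measure α}
    [IsProbabilityMeasure μ] {F : α → ℝ≥0∞} {p : ℝ} (hp : 1 ≤ p) (hF : AEMeasurable F μ) :
    (∫⁻ a, F a ∂μ) ^ p ≤ ∫⁻ a, F a ^ p ∂μ := by
  have h := lintegral_rpow_le_of_one_le hp hF
  rw [measure_univ, ENNReal.one_rpow, mul_one] at h
  calc _ ≤ ((∫⁻ a, F a ^ p ∂μ) ^ (1 / p)) ^ p := by gcongr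
    _ = _ := by rw [← ENNReal.rpow_mul, one_div_mul_cancel (by linarith), ENNReal.rpow_one]

section Haar

variable {V : Type*} [NormedAddCommGroup V] [NormedSpace ℝ V] [FiniteDimensional ℝ V]
  [MeasurableSpace V] [BorelSpace V] {μ : Measure V} [μ.IsAddHaarMeasure]

theorem lintegral_comp_smul_add {F : V → ℝ≥0∞} (hF : Measurable F) {s : ℝ} (hs : s ≠ 0) (c : V) :
    ∫⁻ z, F (s • z + c) ∂μ
      = ENNReal.ofReal (|s| ^ (-(Module.finrank ℝ V : ℝ))) * ∫⁻ z, F z ∂μ := by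
  have h1 : ∫⁻ z, F (s • z + c) ∂μ
      = ∫⁻ z, F (z + c) ∂(Measure.map (fun z => s • z) μ) := by
    rw [lintegral_map (f := fun z => F (z + c)) (hF.comp (measurable_id.add_const c))
      (measurable_const_smul s)]
  rw [h1, Measure.map_addHaar_smul μ hs, lintegral_smul_measure,
    lintegral_add_right_eq_self F c, smul_eq_mul, abs_inv, abs_pow,
    Real.rpow_neg (abs_nonneg s), Real.rpow_natCast]

theorem setLIntegral_comp_homothety_le {Q : Set V} (hQ : Convex ℝ Q) (hQm : MeasurableSet Q)
    {F : V → ℝ≥0∞} (hF : Measurable F) {a : V} (ha : a ∈ Q) {s : ℝ} (hs : s ∈ Ioc (0 : ℝ) 1) :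
    ∫⁻ z in Q, F (a + s • (z - a)) ∂μ
      ≤ ENNReal.ofReal (s ^ (-(Module.finrank ℝ V : ℝ))) * ∫⁻ z in Q, F z ∂μ := by
  have h := lintegral_comp_smul_add (μ := μ) (hF.indicator hQm) hs.1.ne' (a - s • a)
  rw [lintegral_indicator hQm, abs_of_pos hs.1] at h
  rw [← h, ← lintegral_indicator hQm]
  refine lintegral_mono fun z => ?_
  by_cases hz : z ∈ Q
  · have hmem : s • z + (a - s • a) ∈ Q := by
      have := hQ.add_smul_sub_mem ha hz (Ioc_subset_Icc_self hs)
      convert this using 1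
      module
    rw [indicator_of_mem hz, indicator_of_mem hmem]
    refine le_of_eq ?_
    congr 1
    module
  · rw [indicator_of_notMem hz]
    exact zero_le

/-- **Morrey's estimate** on a convex set `Q`. The map `h` is controlled along segments issuing from
`a` by the function `G`, a stand-in for the norm of its differential. Averaging over the endpoint
`z ∈ Q` and substituting `w = a + s (z - a)` for fixed `s` costs a factor `s ^ (-d / p)`, which is
integrable on `(0, 1]` as soon as `p` exceeds the dimension `d`. -/
theorem setLIntegral_enorm_sub_le_of_segment {W : Type*} [NormedAddCommGroup W] {Q : Set V}
    (hQ : Convex ℝ Q) (hQm : MeasurableSet Q) {p : ℝ} (hp : 1 ≤ p) {G : V → ℝ≥0∞}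
    (hG : Measurable G) {h : V → W} {a : V} (ha : a ∈ Q)
    (hseg : ∀ z ∈ Q, ‖h a - h z‖ₑ ≤ ∫⁻ s in Ioc (0 : ℝ) 1, G (a + s • (z - a))) :
    ∫⁻ z in Q, ‖h a - h z‖ₑ ∂μ
      ≤ (∫⁻ s in Ioc (0 : ℝ) 1, ENNReal.ofReal (s ^ (-(Module.finrank ℝ V : ℝ) / p)))
        * μ Q ^ (1 - 1 / p) * (∫⁻ z in Q, G z ^ p ∂μ) ^ (1 / p) := by
  have hp0 : 0 < p := by linarith
  have hmeas : Measurable (fun q : V × ℝ => G (a + q.2 • (q.1 - a))) :=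
    hG.comp (by fun_prop)
  calc ∫⁻ z in Q, ‖h a - h z‖ₑ ∂μ
      ≤ ∫⁻ z in Q, (∫⁻ s in Ioc (0 : ℝ) 1, G (a + s • (z - a))) ∂μ :=
        setLIntegral_mono' hQm hseg
    _ = ∫⁻ s in Ioc (0 : ℝ) 1, (∫⁻ z in Q, G (a + s • (z - a)) ∂μ) := by
        exact lintegral_lintegral_swap hmeas.aemeasurable
    _ ≤ ∫⁻ s in Ioc (0 : ℝ) 1, ENNReal.ofReal (s ^ (-(Module.finrank ℝ V : ℝ) / p))
          * (μ Q ^ (1 - 1 / p) * (∫⁻ z in Q, G z ^ p ∂μ) ^ (1 / p)) := by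
        refine setLIntegral_mono' measurableSet_Ioc fun s hs => ?_
        have h1 := lintegral_rpow_le_of_one_le (μ := μ.restrict Q) hp
          (hG.comp (by fun_prop : Measurable fun z : V => a + s • (z - a))).aemeasurable
        have h2 := setLIntegral_comp_homothety_le (μ := μ) hQ hQm (hG.pow_const p) ha hs
        simp only [Function.comp_def, Measure.restrict_apply_univ] at h1
        have h3 : (ENNReal.ofReal (s ^ (-(Module.finrank ℝ V : ℝ)))) ^ (1 / p)
            = ENNReal.ofReal (s ^ (-(Module.finrank ℝ V : ℝ) / p)) := by
          rw [ENNReal.ofReal_rpow_of_pos (Real.rpow_pos_of_pos hs.1 _),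
            ← Real.rpow_mul hs.1.le, mul_one_div]
        calc _ ≤ _ := h1
          _ ≤ (ENNReal.ofReal (s ^ (-(Module.finrank ℝ V : ℝ))) * ∫⁻ z in Q, G z ^ p ∂μ) ^ (1 / p)
                * μ Q ^ (1 - 1 / p) := by gcongr
          _ = _ := by
            rw [ENNReal.mul_rpow_of_nonneg _ _ (by positivity), h3]
            ring
    _ = _ := by
        rw [lintegral_mul_const _ (by fun_prop), mul_assoc]

/-- The oscillation form of Morrey's estimate: the constant depends only on `Q` and `p`. -/
theorem exists_enorm_sub_le_of_segment {Q : Set V}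
    (hQ : Convex ℝ Q) (hQm : MeasurableSet Q) (hQ0 : μ Q ≠ 0) (hQt : μ Q ≠ ⊤)
    {p : ℝ} (hp : 1 ≤ p) (hpd : (Module.finrank ℝ V : ℝ) < p) :
    ∃ C : ℝ, 0 < C ∧ ∀ {W : Type*} [NormedAddCommGroup W] (G : V → ℝ≥0∞) (h : V → W),
      Measurable G → ContinuousOn h Q →
      (∀ a ∈ Q, ∀ z ∈ Q, ‖h a - h z‖ₑ ≤ ∫⁻ s in Ioc (0 : ℝ) 1, G (a + s • (z - a))) →
      ∀ a ∈ Q, ∀ b ∈ Q, ‖h a - h b‖ₑ ≤ ENNReal.ofReal C * (∫⁻ z in Q, G z ^ p ∂μ) ^ (1 / p) := by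
  have hp0 : 0 < p := by linarith
  set D : ℝ≥0∞ := (∫⁻ s in Ioc (0 : ℝ) 1, ENNReal.ofReal (s ^ (-(Module.finrank ℝ V : ℝ) / p)))
        * μ Q ^ (1 - 1 / p) with hD
  have hDt : D ≠ ⊤ := by
    refine ENNReal.mul_ne_top ?_ (ENNReal.rpow_ne_top_of_nonneg ?_ hQt)
    · have h1 : -1 < -(Module.finrank ℝ V : ℝ) / p := by
        rw [lt_div_iff₀ hp0]; linarith
      have h2 := (intervalIntegral.intervalIntegrable_rpow' h1 (a := 0) (b := 1)).1
      have h3 := h2.lintegral_lt_top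
      exact h3.ne
    · rw [sub_nonneg, div_le_one hp0]; exact hp
  have hEt : (μ Q)⁻¹ * (2 * D) ≠ ⊤ :=
    ENNReal.mul_ne_top (ENNReal.inv_ne_top.2 hQ0) (ENNReal.mul_ne_top (by simp) hDt)
  refine ⟨((μ Q)⁻¹ * (2 * D)).toReal + 1, by positivity, ?_⟩
  intro W _ G h hG hh hseg a ha b hb
  have key : μ Q * ‖h a - h b‖ₑ ≤ 2 * D * (∫⁻ z in Q, G z ^ p ∂μ) ^ (1 / p) := by
    have hA := setLIntegral_enorm_sub_le_of_segment (μ := μ) hQ hQm hp hG ha (hseg a ha)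
    have hB := setLIntegral_enorm_sub_le_of_segment (μ := μ) hQ hQm hp hG hb (hseg b hb)
    have hAm : AEMeasurable (fun z => ‖h a - h z‖ₑ) (μ.restrict Q) :=
      ((continuousOn_const.sub hh).enorm).aemeasurable hQm
    calc μ Q * ‖h a - h b‖ₑ = ∫⁻ z in Q, ‖h a - h b‖ₑ ∂μ := by
          rw [setLIntegral_const, mul_comm]
      _ ≤ ∫⁻ z in Q, (‖h a - h z‖ₑ + ‖h b - h z‖ₑ) ∂μ := by
          refine lintegral_mono fun z => ?_
          have : h a - h b = (h a - h z) - (h b - h z) := by abel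
          rw [this]
          exact enorm_sub_le
      _ = ∫⁻ z in Q, ‖h a - h z‖ₑ ∂μ + ∫⁻ z in Q, ‖h b - h z‖ₑ ∂μ := lintegral_add_left' hAm _
      _ ≤ _ := add_le_add hA hB
      _ = _ := by rw [← two_mul, ← mul_assoc]
  have h1 : ‖h a - h b‖ₑ ≤ (μ Q)⁻¹ * (2 * D) * (∫⁻ z in Q, G z ^ p ∂μ) ^ (1 / p) := by
    rw [mul_assoc, ← ENNReal.mul_le_iff_le_inv hQ0 hQt]
    exact key
  refine h1.trans ?_
  gcongr
  calc (μ Q)⁻¹ * (2 * D) = ENNReal.ofReal ((μ Q)⁻¹ * (2 * D)).toReal :=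
        (ENNReal.ofReal_toReal hEt).symm
    _ ≤ _ := ENNReal.ofReal_le_ofReal (by linarith)

end Haar

/-! ### The faces of a sphere -/

theorem norm_inv_norm_smul_sub_le {E : Type*} [NormedAddCommGroup E] [NormedSpace ℝ E] {u v : E}
    (hu : 1 ≤ ‖u‖) (hv : 1 ≤ ‖v‖) :
    ‖‖u‖⁻¹ • u - ‖v‖⁻¹ • v‖ ≤ 2 * ‖u - v‖ := by
  have hu0 : 0 < ‖u‖ := by linarith
  have hv0 : 0 < ‖v‖ := by linarith
  have e : ‖u‖⁻¹ • u - ‖v‖⁻¹ • v = ‖u‖⁻¹ • ((u - v) + ((‖v‖ - ‖u‖) * ‖v‖⁻¹) • v) := by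
    rw [sub_mul, mul_inv_cancel₀ hv0.ne', sub_smul, one_smul, smul_add, smul_sub, smul_sub,
      smul_smul ‖u‖⁻¹ (_ * _), ← mul_assoc, inv_mul_cancel₀ hu0.ne', one_mul]
    abel
  have h1 : ‖((‖v‖ - ‖u‖) * ‖v‖⁻¹) • v‖ ≤ ‖u - v‖ := by
    rw [norm_smul, norm_mul, norm_inv, norm_norm, mul_assoc, inv_mul_cancel₀ hv0.ne', mul_one,
      norm_sub_rev u v]
    exact abs_norm_sub_norm_le v u
  rw [e, norm_smul, norm_inv, norm_norm]
  calc ‖u‖⁻¹ * ‖(u - v) + ((‖v‖ - ‖u‖) * ‖v‖⁻¹) • v‖ ≤ 1 * (‖u - v‖ + ‖u - v‖) := by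
        gcongr
        · exact inv_le_one_of_one_le₀ hu
        · exact (norm_add_le _ _).trans (by gcongr)
    _ = 2 * ‖u - v‖ := by ring

theorem enorm_sub_le_lintegral_fderiv_of_lipschitz {E W : Type*} [NormedAddCommGroup E]
    [NormedSpace ℝ E] [NormedAddCommGroup W] [NormedSpace ℝ W] [CompleteSpace W]
    {g : E → W} (hg : ContDiff ℝ 1 g) {γ : ℝ → E} (hγ : ContDiff ℝ 1 γ) {K : NNReal}
    (hK : LipschitzWith K γ) :
    ‖g (γ 0) - g (γ 1)‖ₑ ≤ ∫⁻ s in Ioc (0 : ℝ) 1, K * ‖fderiv ℝ g (γ s)‖ₑ := by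
  have hd : ∀ s, HasDerivAt (g ∘ γ) (fderiv ℝ g (γ s) (deriv γ s)) s := fun s =>
    ((hg.differentiable one_ne_zero) (γ s)).hasFDerivAt.comp_hasDerivAt s
      ((hγ.differentiable one_ne_zero) s).hasDerivAt
  have hc : Continuous fun s => fderiv ℝ g (γ s) (deriv γ s) :=
    ((hg.continuous_fderiv one_ne_zero).comp hγ.continuous).clm_apply
      (hγ.continuous_deriv le_rfl)
  have h := intervalIntegral.integral_eq_sub_of_hasDerivAt (a := 0) (b := 1)
    (fun s _ => hd s) (hc.intervalIntegrable _ _)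
  rw [intervalIntegral.integral_of_le zero_le_one] at h
  rw [← enorm_neg, neg_sub]
  change ‖(g ∘ γ) 1 - (g ∘ γ) 0‖ₑ ≤ _
  rw [← h]
  refine (enorm_integral_le_lintegral_enorm _).trans (lintegral_mono fun s => ?_)
  refine ((fderiv ℝ g (γ s)).le_opENorm _).trans ?_
  rw [mul_comm]
  gcongr
  rw [← enorm_norm, Real.enorm_of_nonneg (norm_nonneg _), ← ENNReal.ofReal_coe_nnreal]
  exact ENNReal.ofReal_le_ofReal (norm_deriv_le_of_lipschitz hK)

section Faces

variable {m : ℕ}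

/-- The point of the affine hyperplane `{y | y i = 1}` with remaining coordinates `z`. For
`z ∈ [-1, 1]ᵐ` these points fill a face of the cube `[-1, 1]ᵐ⁺¹`. -/
noncomputable def facePoint (i : Fin (m + 1)) (z : Fin m → ℝ) : EuclideanSpace ℝ (Fin (m + 1)) :=
  WithLp.toLp 2 (i.insertNth 1 z)

/-- The radial projection to the sphere of radius `t` about `0` of the cube face `{y | y i = σ}`,
where `σ = ±1`: the face is parametrized by `z ↦ σ • facePoint i z`. -/
noncomputable def spherePoint (i : Fin (m + 1)) (σ t : ℝ) (z : Fin m → ℝ) :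
    EuclideanSpace ℝ (Fin (m + 1)) :=
  (σ * t * ‖facePoint i z‖⁻¹) • facePoint i z

theorem facePoint_apply_same (i : Fin (m + 1)) (z : Fin m → ℝ) : facePoint i z i = 1 := by
  simp [facePoint]

theorem facePoint_apply_succAbove (i : Fin (m + 1)) (z : Fin m → ℝ) (j : Fin m) :
    facePoint i z (i.succAbove j) = z j := by
  simp [facePoint]

theorem one_le_norm_facePoint (i : Fin (m + 1)) (z : Fin m → ℝ) : 1 ≤ ‖facePoint i z‖ := by
  have h := PiLp.norm_apply_le (facePoint i z) i
  rwa [facePoint_apply_same, norm_one] at h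

theorem norm_facePoint_le (i : Fin (m + 1)) {z : Fin m → ℝ} (hz : z ∈ Icc (-1) 1) :
    ‖facePoint i z‖ ≤ √(m + 1) := by
  rw [EuclideanSpace.norm_eq]
  apply Real.sqrt_le_sqrt
  calc ∑ k, ‖facePoint i z k‖ ^ 2 ≤ ∑ k : Fin (m + 1), (1 : ℝ) := by
        refine Finset.sum_le_sum fun k _ => ?_
        have : ‖facePoint i z k‖ ≤ 1 := by
          rcases Fin.eq_self_or_eq_succAbove i k with rfl | ⟨j, rfl⟩
          · simp [facePoint_apply_same]
          · rw [facePoint_apply_succAbove, Real.norm_eq_abs, abs_le]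
            exact ⟨hz.1 j, hz.2 j⟩
        exact pow_le_one₀ (norm_nonneg _) this
    _ = m + 1 := by simp

theorem facePoint_add_smul_sub (i : Fin (m + 1)) (a z : Fin m → ℝ) (s : ℝ) :
    facePoint i (a + s • (z - a)) = facePoint i a + s • (facePoint i z - facePoint i a) := by
  ext k
  rcases Fin.eq_self_or_eq_succAbove i k with rfl | ⟨j, rfl⟩
  · simp [facePoint_apply_same]
  · simp [facePoint_apply_succAbove]

theorem smul_facePoint (i : Fin (m + 1)) (s : ℝ) (z : Fin m → ℝ) :
    s • facePoint i z = WithLp.toLp 2 (i.insertNth s (s • z)) := by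
  ext k
  rcases Fin.eq_self_or_eq_succAbove i k with rfl | ⟨j, rfl⟩
  · simp [facePoint]
  · simp [facePoint]

theorem continuous_facePoint (i : Fin (m + 1)) : Continuous (facePoint (m := m) i) := by
  unfold facePoint
  fun_prop

theorem continuous_spherePoint (i : Fin (m + 1)) (σ : ℝ) :
    Continuous fun q : ℝ × (Fin m → ℝ) => spherePoint i σ q.1 q.2 := by
  have h := continuous_facePoint (m := m) i
  have h0 : ∀ q : ℝ × (Fin m → ℝ), ‖facePoint i q.2‖ ≠ 0 := fun q => by
    have := one_le_norm_facePoint i q.2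
    positivity
  unfold spherePoint
  have h1 : Continuous fun q : ℝ × (Fin m → ℝ) => facePoint i q.2 := h.comp continuous_snd
  exact ((continuous_const.mul continuous_fst).mul (h1.norm.inv₀ h0)).smul h1

theorem norm_spherePoint (i : Fin (m + 1)) {σ t : ℝ} (hσ : |σ| = 1) (ht : 0 ≤ t)
    (z : Fin m → ℝ) : ‖spherePoint i σ t z‖ = t := by
  have h := one_le_norm_facePoint i z
  rw [spherePoint, norm_smul, norm_mul, norm_mul, Real.norm_eq_abs σ, hσ, norm_inv, norm_norm,
    Real.norm_of_nonneg ht, one_mul, mul_assoc, inv_mul_cancel₀ (by positivity), mul_one]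

/-- The face of the sphere to which a point belongs is read off from its largest coordinate. -/
theorem exists_eq_spherePoint {y : EuclideanSpace ℝ (Fin (m + 1))} {i : Fin (m + 1)} {σ : ℝ}
    (hσ : |σ| = 1) (hi : 0 < σ * y i) (hmax : ∀ k, |y k| ≤ |y i|) :
    ∃ z ∈ Icc (-1 : Fin m → ℝ) 1, y = spherePoint i σ ‖y‖ z := by
  have hyi : y i ≠ 0 := by rintro h; simp [h] at hi
  refine ⟨fun j => y (i.succAbove j) / y i, ?_, ?_⟩
  · have : ∀ j, |y (i.succAbove j) / y i| ≤ 1 := fun j => by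
      rw [abs_div, div_le_one (abs_pos.2 hyi)]
      exact hmax _
    exact ⟨fun j => (abs_le.1 (this j)).1, fun j => (abs_le.1 (this j)).2⟩
  · set z : Fin m → ℝ := fun j => y (i.succAbove j) / y i with hz
    have hy : y = y i • facePoint i z := by
      ext k
      rcases Fin.eq_self_or_eq_succAbove i k with rfl | ⟨j, rfl⟩
      · simp [facePoint_apply_same]
      · simp [facePoint_apply_succAbove, hz, mul_div_cancel₀ _ hyi]
    have hN := one_le_norm_facePoint i z
    have hyn : ‖y‖ = |y i| * ‖facePoint i z‖ := by
      conv_lhs => rw [hy]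
      rw [norm_smul, Real.norm_eq_abs]
    have hs : σ * |y i| = y i := by
      have h1 : σ * σ = 1 := by rw [← abs_mul_abs_self, hσ, one_mul]
      have h2 : |y i| = σ * y i := by
        rw [← abs_of_pos hi, abs_mul, hσ, one_mul]
      rw [h2, ← mul_assoc, h1, one_mul]
    rw [spherePoint, hyn]
    have : σ * (|y i| * ‖facePoint i z‖) * ‖facePoint i z‖⁻¹ = y i := by
      rw [← mul_assoc, hs, mul_assoc, mul_inv_cancel₀ (by positivity), mul_one]
    rw [this]
    exact hy

theorem enorm_spherePoint_segment_le {W : Type*} [NormedAddCommGroup W] [NormedSpace ℝ W]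
    [CompleteSpace W] {g : EuclideanSpace ℝ (Fin (m + 1)) → W} (hg : ContDiff ℝ 1 g)
    (x : EuclideanSpace ℝ (Fin (m + 1))) (i : Fin (m + 1)) {σ t : ℝ} (hσ : |σ| = 1) (ht : 0 < t)
    {a z : Fin m → ℝ} (ha : a ∈ Icc (-1) 1) (hz : z ∈ Icc (-1) 1) :
    ‖g (x + spherePoint i σ t a) - g (x + spherePoint i σ t z)‖ₑ
      ≤ ∫⁻ s in Ioc (0 : ℝ) 1, ENNReal.ofReal (4 * √(m + 1) * t)
          * ‖fderiv ℝ g (x + spherePoint i σ t (a + s • (z - a)))‖ₑ := by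
  set y : ℝ → EuclideanSpace ℝ (Fin (m + 1)) := fun s => facePoint i (a + s • (z - a)) with hy
  have hyeq : ∀ s, y s = facePoint i a + s • (facePoint i z - facePoint i a) := fun s =>
    facePoint_add_smul_sub i a z s
  have hy1 : ∀ s, 1 ≤ ‖y s‖ := fun s => one_le_norm_facePoint i _
  have hyC : ContDiff ℝ 1 y := by
    rw [show y = _ from funext hyeq]
    fun_prop
  have hyne : ∀ s, y s ≠ 0 := fun s => by
    have := hy1 s
    rw [← norm_pos_iff]; linarith
  have hγC : ContDiff ℝ 1 fun s : ℝ => x + spherePoint i σ t (a + s • (z - a)) := by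
    have h1 : ContDiff ℝ 1 fun s => ‖y s‖ := hyC.norm ℝ hyne
    have h2 : ContDiff ℝ 1 fun s => ‖y s‖⁻¹ := h1.inv fun s => norm_ne_zero_iff.2 (hyne s)
    exact contDiff_const.add ((contDiff_const.mul h2).smul hyC)
  have hL : LipschitzWith (4 * √(m + 1) * t).toNNReal
      fun s : ℝ => x + spherePoint i σ t (a + s • (z - a)) := by
    refine LipschitzWith.of_dist_le_mul fun s s' => ?_
    rw [Real.coe_toNNReal _ (by positivity), dist_add_left, dist_eq_norm, Real.dist_eq]
    have e : spherePoint i σ t (a + s • (z - a)) - spherePoint i σ t (a + s' • (z - a))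
        = (σ * t) • (‖y s‖⁻¹ • y s - ‖y s'‖⁻¹ • y s') := by
      simp only [spherePoint, hy, smul_sub, smul_smul]
    have hd : ‖y s - y s'‖ ≤ |s - s'| * (2 * √(m + 1)) := by
      rw [hyeq, hyeq, add_sub_add_left_eq_sub, ← sub_smul, norm_smul, Real.norm_eq_abs]
      gcongr
      calc _ ≤ ‖facePoint i z‖ + ‖facePoint i a‖ := norm_sub_le _ _
        _ ≤ _ := by
          have := norm_facePoint_le i ha
          have := norm_facePoint_le i hz
          linarith
    rw [e, norm_smul, norm_mul, Real.norm_eq_abs σ, hσ, one_mul, Real.norm_of_nonneg ht.le]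
    calc t * _ ≤ t * (2 * (|s - s'| * (2 * √(m + 1)))) := by
          gcongr
          exact (norm_inv_norm_smul_sub_le (hy1 s) (hy1 s')).trans (by gcongr)
      _ = _ := by ring
  have h := enorm_sub_le_lintegral_fderiv_of_lipschitz hg hγC hL
  simpa [ENNReal.ofReal] using h

/-- Morrey's estimate on one face of the sphere of radius `t` about `x`. The face has dimension
`m`, hence the hypothesis `m < p`. -/
theorem exists_enorm_sub_le_on_face {p : ℝ} (hp : 1 ≤ p) (hmp : (m : ℝ) < p) :
    ∃ C : ℝ, 0 < C ∧ ∀ {W : Type*} [NormedAddCommGroup W] [NormedSpace ℝ W] [CompleteSpace W]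
      {g : EuclideanSpace ℝ (Fin (m + 1)) → W} (_ : ContDiff ℝ 1 g)
      (x : EuclideanSpace ℝ (Fin (m + 1))) (i : Fin (m + 1)) {σ t : ℝ} (_ : |σ| = 1) (_ : 0 < t)
      {a b : Fin m → ℝ} (_ : a ∈ Icc (-1) 1) (_ : b ∈ Icc (-1) 1),
      ‖g (x + spherePoint i σ t a) - g (x + spherePoint i σ t b)‖ₑ ≤ ENNReal.ofReal (C * t) *
        (∫⁻ z in Icc (-1) 1, ‖fderiv ℝ g (x + spherePoint i σ t z)‖ₑ ^ p) ^ (1 / p) := by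
  have hp0 : 0 < p := by linarith
  have hvol : volume (Icc (-1 : Fin m → ℝ) 1) = ENNReal.ofReal (2 ^ m) := by
    rw [Real.volume_Icc_pi]
    norm_num [ENNReal.ofReal_pow]
  obtain ⟨C, hC, H⟩ := exists_enorm_sub_le_of_segment (μ := (volume : Measure (Fin m → ℝ)))
    (Q := Icc (-1) 1) (convex_Icc _ _) measurableSet_Icc
    (by rw [hvol]; simp) (by rw [hvol]; simp) hp (by simpa using hmp)
  refine ⟨C * (4 * √(m + 1)), by positivity, ?_⟩
  intro W _ _ _ g hg x i σ t hσ ht a b ha hb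
  have hcont : Continuous fun z : Fin m → ℝ => x + spherePoint i σ t z :=
    continuous_const.add ((continuous_spherePoint i σ).comp (by fun_prop :
      Continuous fun z : Fin m → ℝ => (t, z)))
  have hG : Continuous fun z : Fin m → ℝ => ‖fderiv ℝ g (x + spherePoint i σ t z)‖ₑ :=
    ((hg.continuous_fderiv one_ne_zero).comp hcont).enorm
  have h := H (fun z => ENNReal.ofReal (4 * √(m + 1) * t) *
      ‖fderiv ℝ g (x + spherePoint i σ t z)‖ₑ) (fun z => g (x + spherePoint i σ t z))
      (hG.measurable.const_mul _) (hg.continuous.comp hcont).continuousOn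
      (fun a ha z hz => enorm_spherePoint_segment_le hg x i hσ ht ha hz) a ha b hb
  refine h.trans (le_of_eq ?_)
  simp_rw [ENNReal.mul_rpow_of_nonneg _ _ hp0.le]
  rw [lintegral_const_mul _ (hG.measurable.pow_const p),
    ENNReal.mul_rpow_of_nonneg _ _ (by positivity), ← ENNReal.rpow_mul,
    mul_one_div_cancel hp0.ne', ENNReal.rpow_one, ← mul_assoc, ← ENNReal.ofReal_mul hC.le]
  congr 2
  ring

end Faces

/-! ### Oscillation on spheres and integration over the radius -/

theorem isClosed_closedAnnulus {n : ℕ} (x : EuclideanSpace ℝ (Fin n)) (r R : ℝ) :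
    IsClosed (closedAnnulus x r R) := by
  have hc : Continuous fun y => dist x y := by fun_prop
  exact (isClosed_Ici.preimage hc).inter (isClosed_Iic.preimage hc)

section Sphere

variable {m : ℕ}

/-- The sum of the integrals of `F`, in the parameter `z ∈ [-1, 1]ᵐ`, over the `2 (m + 1)` faces of
the sphere of radius `t` about `x`. It takes the place of the surface integral. -/
noncomputable def faceLIntegral (F : EuclideanSpace ℝ (Fin (m + 1)) → ℝ≥0∞)
    (x : EuclideanSpace ℝ (Fin (m + 1))) (t : ℝ) : ℝ≥0∞ :=
  ∑ i, ∑ σ ∈ ({1, -1} : Finset ℝ), ∫⁻ z in Icc (-1) 1, F (x + spherePoint i σ t z)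

theorem setLIntegral_le_faceLIntegral (F : EuclideanSpace ℝ (Fin (m + 1)) → ℝ≥0∞)
    (x : EuclideanSpace ℝ (Fin (m + 1))) (t : ℝ) (i : Fin (m + 1)) {σ : ℝ} (hσ : σ = 1 ∨ σ = -1) :
    ∫⁻ z in Icc (-1) 1, F (x + spherePoint i σ t z) ≤ faceLIntegral F x t := by
  have h1 := Finset.single_le_sum (s := ({1, -1} : Finset ℝ)) (a := σ)
    (f := fun σ => ∫⁻ z in Icc (-1) 1, F (x + spherePoint i σ t z)) (fun _ _ => zero_le)
    (by simpa using hσ)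
  have h2 := Finset.single_le_sum (s := Finset.univ) (a := i)
    (f := fun i => ∑ σ ∈ ({1, -1} : Finset ℝ), ∫⁻ z in Icc (-1) 1, F (x + spherePoint i σ t z))
    (fun _ _ => zero_le) (Finset.mem_univ i)
  exact h1.trans h2

/-- A bound on the oscillation over each face propagates to the whole sphere: the vertex with all
coordinates positive lies on every positive face, and the vertex obtained from it by flipping
coordinate `i` links it to the negative face `i`. -/
theorem edist_le_of_face {W : Type*} [PseudoEMetricSpace W] (hm : 1 ≤ m)
    {h : EuclideanSpace ℝ (Fin (m + 1)) → W} {t : ℝ} (ht : 0 < t) {K : ℝ≥0∞}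
    (hK : ∀ (i : Fin (m + 1)) (σ : ℝ), (σ = 1 ∨ σ = -1) →
      ∀ y y' : EuclideanSpace ℝ (Fin (m + 1)), ‖y‖ = t → ‖y'‖ = t → 0 < σ * y i → 0 < σ * y' i →
      (∀ k, |y k| ≤ |y i|) → (∀ k, |y' k| ≤ |y' i|) → edist (h y) (h y') ≤ K)
    {y y' : EuclideanSpace ℝ (Fin (m + 1))} (hy : ‖y‖ = t) (hy' : ‖y'‖ = t) :
    edist (h y) (h y') ≤ 4 * K := by
  have hnt : Nontrivial (Fin (m + 1)) := Fin.nontrivial_iff_two_le.2 (by omega)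
  set ρ : ℝ := t / √(m + 1) with hρ
  have hρ0 : 0 < ρ := by positivity
  let c : (Fin (m + 1) → ℝ) → EuclideanSpace ℝ (Fin (m + 1)) := fun v => ρ • WithLp.toLp 2 v
  have hcn : ∀ v : Fin (m + 1) → ℝ, (∀ k, |v k| = 1) → ‖c v‖ = t := fun v hv => by
    have : ‖(WithLp.toLp 2 v : EuclideanSpace ℝ (Fin (m + 1)))‖ = √(m + 1) := by
      rw [EuclideanSpace.norm_eq]
      simp [hv]
    rw [norm_smul, this, Real.norm_of_nonneg hρ0.le, hρ, div_mul_cancel₀ _ (by positivity)]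
  have hca : ∀ v k, c v k = ρ * v k := fun v k => by simp [c]
  have hcm : ∀ v : Fin (m + 1) → ℝ, (∀ k, |v k| = 1) → ∀ i k, |c v k| ≤ |c v i| :=
    fun v hv i k => by rw [hca, hca, abs_mul, abs_mul, hv, hv]
  have hone : ∀ k : Fin (m + 1), |(fun _ => 1 : Fin (m + 1) → ℝ) k| = 1 := fun k => by simp
  have hflip : ∀ i k : Fin (m + 1), |Function.update (fun _ => 1 : Fin (m + 1) → ℝ) i (-1) k| = 1 :=
    fun i k => by
      rcases eq_or_ne k i with rfl | hk
      · simp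
      · simp [hk]
  have main : ∀ y : EuclideanSpace ℝ (Fin (m + 1)), ‖y‖ = t →
      edist (h y) (h (c fun _ => 1)) ≤ 2 * K := by
    intro y hy
    obtain ⟨i, -, hi⟩ := Finset.exists_max_image Finset.univ (fun k => |y k|) Finset.univ_nonempty
    have hmax : ∀ k, |y k| ≤ |y i| := fun k => hi k (Finset.mem_univ k)
    have hyi : y i ≠ 0 := by
      intro h0
      have : y = 0 := by
        ext k
        have := hmax k
        rw [h0, abs_zero] at this
        simpa using this
      rw [this, norm_zero] at hy
      exact ht.ne hy
    rcases lt_or_gt_of_ne hyi with hneg | hpos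
    · obtain ⟨j, hj⟩ := exists_ne i
      set v : Fin (m + 1) → ℝ := Function.update (fun _ => 1) i (-1) with hv
      have h1 : edist (h y) (h (c v)) ≤ K := by
        refine hK i (-1) (Or.inr rfl) y (c v) hy (hcn v (hflip i)) (by linarith) ?_ hmax
          (hcm v (hflip i) i)
        rw [hca, hv, Function.update_self]; linarith
      have h2 : edist (h (c v)) (h (c fun _ => 1)) ≤ K := by
        refine hK j 1 (Or.inl rfl) (c v) (c _) (hcn v (hflip i)) (hcn _ hone) ?_ ?_
          (hcm v (hflip i) j) (hcm _ hone j)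
        · rw [hca, hv, Function.update_of_ne hj]; linarith
        · rw [hca]; linarith
      calc _ ≤ _ := edist_triangle _ (h (c v)) _
        _ ≤ K + K := add_le_add h1 h2
        _ = 2 * K := (two_mul K).symm
    · have h1 : edist (h y) (h (c fun _ => 1)) ≤ K := by
        refine hK i 1 (Or.inl rfl) y (c _) hy (hcn _ hone) (by linarith) ?_ hmax (hcm _ hone i)
        rw [hca]; linarith
      calc _ ≤ _ := h1
        _ = 1 * K := (one_mul K).symm
        _ ≤ 2 * K := by gcongr; norm_num
  calc edist (h y) (h y') ≤ edist (h y) (h (c fun _ => 1)) + edist (h y') (h (c fun _ => 1)) :=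
        edist_triangle_right _ _ _
    _ ≤ 2 * K + 2 * K := add_le_add (main y hy) (main y' hy')
    _ = 4 * K := by rw [← add_mul]; norm_num

/-- The Sobolev embedding on spheres, for exponents above the dimension `m` of the sphere. -/
theorem exists_enorm_sub_le_on_sphere (hm : 1 ≤ m) {p : ℝ} (hmp : (m : ℝ) < p) :
    ∃ C : ℝ, 0 < C ∧ ∀ {W : Type*} [NormedAddCommGroup W] [NormedSpace ℝ W] [CompleteSpace W]
      {g : EuclideanSpace ℝ (Fin (m + 1)) → W} (_ : ContDiff ℝ 1 g)
      (x : EuclideanSpace ℝ (Fin (m + 1))) {t : ℝ} (_ : 0 < t)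
      {y y' : EuclideanSpace ℝ (Fin (m + 1))} (_ : ‖y‖ = t) (_ : ‖y'‖ = t),
      ‖g (x + y) - g (x + y')‖ₑ ≤ ENNReal.ofReal (C * t) *
        (faceLIntegral (fun w => ‖fderiv ℝ g w‖ₑ ^ p) x t) ^ (1 / p) := by
  have hp : 1 ≤ p := by
    have : (1 : ℝ) ≤ m := by exact_mod_cast hm
    linarith
  obtain ⟨C, hC, H⟩ := exists_enorm_sub_le_on_face (m := m) hp hmp
  refine ⟨4 * C, by positivity, ?_⟩
  intro W _ _ _ g hg x t ht y y' hy hy'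
  have h := edist_le_of_face hm (h := fun y => g (x + y)) ht (K := ENNReal.ofReal (C * t) *
        (faceLIntegral (fun w => ‖fderiv ℝ g w‖ₑ ^ p) x t) ^ (1 / p)) ?_ hy hy'
  · rw [edist_eq_enorm_sub] at h
    refine h.trans (le_of_eq ?_)
    rw [← mul_assoc, mul_assoc 4 C t, ENNReal.ofReal_mul (by norm_num : (0 : ℝ) ≤ 4)]
    norm_num
  · intro i σ hσ y y' hy hy' hyi hyi' hmax hmax'
    have hσ1 : |σ| = 1 := by rcases hσ with rfl | rfl <;> simp
    obtain ⟨a, ha, hya⟩ := exists_eq_spherePoint hσ1 hyi hmax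
    obtain ⟨b, hb, hyb⟩ := exists_eq_spherePoint hσ1 hyi' hmax'
    rw [hy] at hya
    rw [hy'] at hyb
    rw [edist_eq_enorm_sub, hya, hyb]
    refine (H hg x i hσ1 ht ha hb).trans ?_
    gcongr
    exact setLIntegral_le_faceLIntegral (fun w => ‖fderiv ℝ g w‖ₑ ^ p) x t i hσ

theorem lintegral_lintegral_toLp_insertNth (i : Fin (m + 1))
    {F : EuclideanSpace ℝ (Fin (m + 1)) → ℝ≥0∞} (hF : Measurable F) :
    ∫⁻ s : ℝ, ∫⁻ w : Fin m → ℝ, F (WithLp.toLp 2 (i.insertNth s w)) = ∫⁻ y, F y := by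
  have hF1 : Measurable fun v : Fin (m + 1) → ℝ => F (WithLp.toLp 2 v) :=
    hF.comp (PiLp.volume_preserving_toLp (Fin (m + 1))).measurable
  have h1 := (PiLp.volume_preserving_toLp (Fin (m + 1))).lintegral_comp hF
  have h2 := ((volume_preserving_piFinSuccAbove (fun _ : Fin (m + 1) => ℝ) i).symm).lintegral_comp
    hF1
  rw [← h1, ← h2]
  exact (lintegral_prod _
    (hF1.comp (MeasurableEquiv.piFinSuccAbove (fun _ => ℝ) i).symm.measurable).aemeasurable).symm

theorem lintegral_comp_mul_right {F : ℝ → ℝ≥0∞} (hF : Measurable F) {c : ℝ} (hc : c ≠ 0) :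
    ∫⁻ t : ℝ, F (t * c) = ENNReal.ofReal |c|⁻¹ * ∫⁻ s, F s := by
  have h := lintegral_comp_smul_add (μ := (volume : Measure ℝ)) hF hc 0
  simp only [smul_eq_mul, add_zero, Module.finrank_self, Nat.cast_one, Real.rpow_neg_one] at h
  rw [← h]
  simp_rw [mul_comm c]

/-- Integration over the cone on one face of the sphere. For fixed `z` the radius `t` is replaced
by `s = σ t / ‖facePoint i z‖`, and then for fixed `s` the variable `z` by `w = s z`; the point
`(s, w)` runs through a part of the annulus, where `|s| ≥ r / √(m + 1)`. -/
theorem lintegral_spherePoint_le (x : EuclideanSpace ℝ (Fin (m + 1)))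
    {F : EuclideanSpace ℝ (Fin (m + 1)) → ℝ≥0∞} (hF : Measurable F) (i : Fin (m + 1)) {σ r R : ℝ}
    (hσ : |σ| = 1) (hr : 0 < r) :
    ∫⁻ t in Ioo r R, ∫⁻ z in Icc (-1) 1, F (x + spherePoint i σ t z)
      ≤ ENNReal.ofReal (√(m + 1) * (r / √(m + 1)) ^ (-(m : ℝ)))
        * ∫⁻ y in closedAnnulus x r R, F y := by
  set B : ℝ := √(m + 1) with hB
  have hB0 : 0 < B := by positivity
  have hAm : MeasurableSet (closedAnnulus x r R) := (isClosed_closedAnnulus x r R).measurableSet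
  set F' : EuclideanSpace ℝ (Fin (m + 1)) → ℝ≥0∞ :=
    fun y => (closedAnnulus x r R).indicator F (x + y) with hF'
  have hF'm : Measurable F' := (hF.indicator hAm).comp (measurable_const_add x)
  set k : (Fin m → ℝ) → ℝ → ℝ≥0∞ :=
    fun z s => {s : ℝ | r / B ≤ |s|}.indicator (fun s => F' (s • facePoint i z)) s with hk
  have hSm : MeasurableSet {s : ℝ | r / B ≤ |s|} :=
    (isClosed_Ici.preimage (continuous_abs (G := ℝ))).measurableSet
  have hpm : Measurable fun q : (Fin m → ℝ) × ℝ => F' (q.2 • facePoint i q.1) :=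
    hF'm.comp (continuous_snd.smul ((continuous_facePoint i).comp continuous_fst)).measurable
  have hkm : Measurable (Function.uncurry k) :=
    hpm.indicator (measurable_snd hSm)
  have hspm : Measurable fun q : ℝ × (Fin m → ℝ) => F (x + spherePoint i σ q.1 q.2) :=
    hF.comp (continuous_const.add (continuous_spherePoint i σ)).measurable
  have radial : ∀ z ∈ Icc (-1 : Fin m → ℝ) 1,
      ∫⁻ t in Ioo r R, F (x + spherePoint i σ t z) ≤ ENNReal.ofReal B * ∫⁻ s, k z s := by
    intro z hz
    have hN := one_le_norm_facePoint i z
    have hNB := norm_facePoint_le i hz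
    have hN0 : 0 < ‖facePoint i z‖ := by linarith
    set c : ℝ := σ * ‖facePoint i z‖⁻¹ with hc
    have hcabs : |c| = ‖facePoint i z‖⁻¹ := by
      rw [hc, abs_mul, hσ, one_mul, abs_of_pos (by positivity)]
    have hc0 : c ≠ 0 := by
      rw [← abs_pos, hcabs]; positivity
    have h1 := lintegral_comp_mul_right (hkm.comp (measurable_prodMk_left (x := z))) hc0
    simp only [Function.comp_def, Function.uncurry] at h1
    calc ∫⁻ t in Ioo r R, F (x + spherePoint i σ t z)
        ≤ ∫⁻ t : ℝ, k z (t * c) := by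
          rw [← lintegral_indicator measurableSet_Ioo]
          refine lintegral_mono fun t => ?_
          by_cases ht : t ∈ Ioo r R
          · have ht0 : 0 < t := hr.trans ht.1
            have hmem : r / B ≤ |t * c| := by
              rw [abs_mul, hcabs, abs_of_pos ht0, ← div_eq_mul_inv]
              exact div_le_div₀ ht0.le ht.1.le hN0 hNB
            have hsp : (t * c) • facePoint i z = spherePoint i σ t z := by
              rw [spherePoint, hc]
              congr 1
              ring
            have hann : x + spherePoint i σ t z ∈ closedAnnulus x r R := by
              simp only [closedAnnulus, mem_ofPred_eq, dist_self_add_right,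
                norm_spherePoint i hσ ht0.le]
              exact ⟨ht.1.le, ht.2.le⟩
            rw [indicator_of_mem ht]
            simp only [hk]
            rw [indicator_of_mem (show t * c ∈ {s : ℝ | r / B ≤ |s|} from hmem), hsp]
            simp only [hF']
            rw [indicator_of_mem hann]
          · rw [indicator_of_notMem ht]
            exact zero_le
      _ = ENNReal.ofReal |c|⁻¹ * ∫⁻ s, k z s := h1
      _ ≤ _ := by
          rw [hcabs, inv_inv]
          gcongr
  have slice : ∀ s : ℝ, ∫⁻ z in Icc (-1 : Fin m → ℝ) 1, k z s
      ≤ ENNReal.ofReal ((r / B) ^ (-(m : ℝ)))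
        * ∫⁻ w : Fin m → ℝ, F' (WithLp.toLp 2 (i.insertNth s w)) := by
    intro s
    by_cases hs : r / B ≤ |s|
    · have hs0 : 0 < |s| := lt_of_lt_of_le (by positivity) hs
      have hm1 : Measurable fun w : Fin m → ℝ => F' (WithLp.toLp 2 (i.insertNth s w)) :=
        hF'm.comp (Continuous.measurable (by fun_prop))
      have h1 := lintegral_comp_smul_add (μ := (volume : Measure (Fin m → ℝ))) hm1
        (abs_pos.1 hs0) 0
      simp only [add_zero, Module.finrank_pi, Fintype.card_fin, ← smul_facePoint] at h1
      calc ∫⁻ z in Icc (-1 : Fin m → ℝ) 1, k z s ≤ ∫⁻ z : Fin m → ℝ, F' (s • facePoint i z) := by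
            refine (setLIntegral_le_lintegral _ _).trans (lintegral_mono fun z => ?_)
            exact indicator_le_self _ (fun s => F' (s • facePoint i z)) s
        _ = _ := h1
        _ ≤ _ := by
            gcongr ?_ * _
            apply ENNReal.ofReal_le_ofReal
            exact Real.rpow_le_rpow_of_nonpos (by positivity) hs (by simp)
    · have : ∀ z, k z s = 0 := fun z =>
        indicator_of_notMem (s := {s : ℝ | r / B ≤ |s|}) hs _
      simp [this]
  calc ∫⁻ t in Ioo r R, ∫⁻ z in Icc (-1) 1, F (x + spherePoint i σ t z)
      = ∫⁻ z in Icc (-1) 1, ∫⁻ t in Ioo r R, F (x + spherePoint i σ t z) :=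
        lintegral_lintegral_swap hspm.aemeasurable
    _ ≤ ∫⁻ z in Icc (-1 : Fin m → ℝ) 1, ENNReal.ofReal B * ∫⁻ s, k z s :=
        setLIntegral_mono' measurableSet_Icc radial
    _ = ENNReal.ofReal B * ∫⁻ s, ∫⁻ z in Icc (-1 : Fin m → ℝ) 1, k z s := by
        have hk1 : Measurable fun z => ∫⁻ s, k z s := Measurable.lintegral_prod_right' hkm
        rw [lintegral_const_mul _ hk1, lintegral_lintegral_swap hkm.aemeasurable]
    _ ≤ ENNReal.ofReal B * ∫⁻ s : ℝ, ENNReal.ofReal ((r / B) ^ (-(m : ℝ)))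
          * ∫⁻ w : Fin m → ℝ, F' (WithLp.toLp 2 (i.insertNth s w)) := by
        gcongr with s
        exact slice s
    _ = ENNReal.ofReal (B * (r / B) ^ (-(m : ℝ))) * ∫⁻ y, F' y := by
        rw [lintegral_const_mul, lintegral_lintegral_toLp_insertNth i hF'm, ← mul_assoc,
          ENNReal.ofReal_mul hB0.le]
        exact Measurable.lintegral_prod_right' (f := fun q : ℝ × (Fin m → ℝ) =>
          F' (WithLp.toLp 2 (i.insertNth q.1 q.2)))
          (hF'm.comp (Continuous.measurable (by fun_prop)))
    _ = _ := by
        rw [hF', lintegral_add_left_eq_self ((closedAnnulus x r R).indicator F) x,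
          lintegral_indicator hAm]

theorem lintegral_faceLIntegral_le (x : EuclideanSpace ℝ (Fin (m + 1)))
    {F : EuclideanSpace ℝ (Fin (m + 1)) → ℝ≥0∞} (hF : Measurable F) {r R : ℝ} (hr : 0 < r) :
    ∫⁻ t in Ioo r R, faceLIntegral F x t
      ≤ ENNReal.ofReal (2 * (m + 1) * (√(m + 1) * (r / √(m + 1)) ^ (-(m : ℝ))))
        * ∫⁻ y in closedAnnulus x r R, F y := by
  have hm : ∀ i σ, Measurable fun t => ∫⁻ z in Icc (-1) 1, F (x + spherePoint i σ t z) :=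
    fun i σ => Measurable.lintegral_prod_right' (f := fun q : ℝ × (Fin m → ℝ) =>
      F (x + spherePoint i σ q.1 q.2))
      (hF.comp (continuous_const.add (continuous_spherePoint i σ)).measurable)
  unfold faceLIntegral
  rw [lintegral_finsetSum _ fun i _ => Finset.measurable_fun_sum _ fun σ _ => hm i σ]
  simp_rw [lintegral_finsetSum ({1, -1} : Finset ℝ) fun σ _ => hm _ σ]
  calc _ ≤ ∑ _i : Fin (m + 1), ∑ _σ ∈ ({1, -1} : Finset ℝ),
          ENNReal.ofReal (√(m + 1) * (r / √(m + 1)) ^ (-(m : ℝ)))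
            * ∫⁻ y in closedAnnulus x r R, F y := by
        refine Finset.sum_le_sum fun i _ => Finset.sum_le_sum fun σ hσ => ?_
        refine lintegral_spherePoint_le x hF i ?_ hr
        rcases (by simpa using hσ : σ = 1 ∨ σ = -1) with rfl | rfl <;> simp
    _ = _ := by
        rw [Finset.sum_const, Finset.sum_const, Finset.card_pair (by norm_num), Finset.card_univ,
          Fintype.card_fin, nsmul_eq_mul, nsmul_eq_mul, ← mul_assoc, ← mul_assoc,
          ENNReal.ofReal_mul (by positivity : (0 : ℝ) ≤ 2 * (m + 1)),
          ← ENNReal.ofReal_natCast (m + 1), ← ENNReal.ofReal_natCast 2,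
          ← ENNReal.ofReal_mul (by positivity)]
        congr 3
        push_cast
        ring

end Sphere

/-! ### Mollification of Sobolev maps -/

section Mollification

variable {n : ℕ}

/-- The differential of a mollification of `f` is the mollification of the weak differential. -/
theorem enorm_fderiv_convolution_le {Ω K : Set (EuclideanSpace ℝ (Fin n))}
    {f : EuclideanSpace ℝ (Fin n) → EuclideanSpace ℝ (Fin n)}
    {Df : EuclideanSpace ℝ (Fin n) → EuclideanSpace ℝ (Fin n) →L[ℝ] EuclideanSpace ℝ (Fin n)}
    (hS : HasWeakFDerivOn Ω f Df) (hK : MeasurableSet K) (hKΩ : K ⊆ Ω)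
    (hΩ : MeasurableSet Ω) (hfK : IntegrableOn f K)
    {ψ : EuclideanSpace ℝ (Fin n) → ℝ} (hψ : ContDiff ℝ ∞ ψ) {ε : ℝ}
    (hsupp : Function.support ψ ⊆ ball 0 ε) {y : EuclideanSpace ℝ (Fin n)}
    (hy : closedBall y ε ⊆ K) :
    ‖fderiv ℝ (convolution ψ (K.indicator f) (ContinuousLinearMap.lsmul ℝ ℝ) volume) y‖ₑ
      ≤ ∫⁻ w, ‖ψ (y - w)‖ₑ * K.indicator (fun w => ‖Df w‖ₑ) w := by
  have hts : tsupport ψ ⊆ closedBall 0 ε := closure_minimal (hsupp.trans ball_subset_closedBall)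
    isClosed_closedBall
  have hψc : HasCompactSupport ψ := HasCompactSupport.of_support_subset_isCompact
    (isCompact_closedBall 0 ε) (hsupp.trans ball_subset_closedBall)
  have hψ1 : ContDiff ℝ 1 ψ := hψ.of_le (by exact_mod_cast le_top)
  have hf : LocallyIntegrable (K.indicator f) :=
    ((integrable_indicator_iff hK).2 hfK).locallyIntegrable
  have hψ0 : ∀ w, w ∉ closedBall y ε → ψ (y - w) = 0 := by
    intro w hw
    by_contra h
    apply hw
    have := hsupp h
    rw [mem_ball_zero_iff] at this
    rw [mem_closedBall, dist_comm, dist_eq_norm]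
    exact this.le
  have hψ'0 : ∀ w, w ∉ closedBall y ε → fderiv ℝ ψ (y - w) = 0 := by
    intro w hw
    by_contra h
    apply hw
    have := hts (support_fderiv_subset ℝ h)
    rw [mem_closedBall_zero_iff] at this
    rw [mem_closedBall, dist_comm, dist_eq_norm]
    exact this
  set θ : EuclideanSpace ℝ (Fin n) → ℝ := fun w => ψ (y - w) with hθ
  have hθC : ContDiff ℝ ∞ θ := hψ.comp (contDiff_const.sub contDiff_id)
  have hθsupp : Function.support θ ⊆ closedBall y ε := fun w hw => by
    by_contra h
    exact hw (hψ0 w h)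
  have hθc : HasCompactSupport θ := HasCompactSupport.of_support_subset_isCompact
    (isCompact_closedBall y ε) hθsupp
  have hθt : tsupport θ ⊆ Ω :=
    (closure_minimal hθsupp isClosed_closedBall).trans (hy.trans hKΩ)
  have hθ' : ∀ w v, fderiv ℝ θ w v = -(fderiv ℝ ψ (y - w) v) := by
    intro w v
    have h1 : HasFDerivAt θ ((fderiv ℝ ψ (y - w)).comp
        (-ContinuousLinearMap.id ℝ (EuclideanSpace ℝ (Fin n)))) w :=
      ((hψ1.differentiable one_ne_zero) (y - w)).hasFDerivAt.comp w
        ((hasFDerivAt_id w).const_sub y)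
    rw [h1.fderiv]
    simp
  apply ContinuousLinearMap.opENorm_le_bound
  intro v
  have hder := (hψc.hasFDerivAt_convolution_left (ContinuousLinearMap.lsmul ℝ ℝ) hψ1 hf y).fderiv
  have hex := (hψc.fderiv ℝ).convolutionExists_left
    (ContinuousLinearMap.precompL (EuclideanSpace ℝ (Fin n))
      (ContinuousLinearMap.lsmul ℝ ℝ : ℝ →L[ℝ] EuclideanSpace ℝ (Fin n) →L[ℝ] _))
    (hψ1.continuous_fderiv one_ne_zero) hf y
  have e1 : fderiv ℝ (convolution ψ (K.indicator f) (ContinuousLinearMap.lsmul ℝ ℝ) volume) y v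
      = ∫ w, (fderiv ℝ ψ (y - w) v) • K.indicator f w := by
    rw [hder, convolution_def, ContinuousLinearMap.integral_apply hex]
    rw [← integral_sub_left_eq_self (fun w => (fderiv ℝ ψ (y - w) v) • K.indicator f w) volume y]
    congr 1
    ext1 t
    rw [ContinuousLinearMap.precompL_apply, sub_sub_cancel, ContinuousLinearMap.lsmul_apply]
  have e2 : ∫ w, (fderiv ℝ ψ (y - w) v) • K.indicator f w
      = ∫ w in Ω, (fderiv ℝ ψ (y - w) v) • f w := by
    rw [← integral_indicator hΩ]
    congr 1
    ext1 w
    by_cases hw : w ∈ closedBall y ε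
    · rw [indicator_of_mem (hy hw), indicator_of_mem (hKΩ (hy hw))]
    · classical
      rw [indicator_apply, indicator_apply]
      simp [hψ'0 w hw]
  have e3 : ∫ w in Ω, (fderiv ℝ ψ (y - w) v) • f w = ∫ w in Ω, ψ (y - w) • Df w v := by
    have h := hS.integral_by_parts θ hθC hθc hθt v
    simp only [hθ', neg_smul, integral_neg, neg_inj] at h
    exact h
  rw [e1, e2, e3]
  refine (enorm_integral_le_lintegral_enorm _).trans ?_
  rw [← lintegral_mul_const' _ _ enorm_ne_top, ← lintegral_indicator hΩ]
  refine lintegral_mono fun w => ?_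
  by_cases hw : w ∈ closedBall y ε
  · rw [indicator_of_mem (hKΩ (hy hw)), indicator_of_mem (hy hw), enorm_smul, mul_assoc]
    gcongr
    exact (Df w).le_opENorm v
  · classical
    rw [indicator_apply]
    simp [hψ0 w hw]

/-- A smooth map that is uniformly close to `f` on a slightly smaller ball, and whose `p`-energy on
a slightly smaller annulus is at most that of `f`. The energy bound is Jensen's inequality for the
probability measures `ψ (y - ·)`, where `ψ` is the mollifier. -/
theorem exists_contDiff_approx {Ω : Set (EuclideanSpace ℝ (Fin n))} {p : ℝ} (hp : 1 ≤ p)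
    {f : EuclideanSpace ℝ (Fin n) → EuclideanSpace ℝ (Fin n)}
    {Df : EuclideanSpace ℝ (Fin n) → EuclideanSpace ℝ (Fin n) →L[ℝ] EuclideanSpace ℝ (Fin n)}
    (hS : HasWeakFDerivOn Ω f Df) (hΩ : MeasurableSet Ω) (hf : ContinuousOn f Ω)
    (x : EuclideanSpace ℝ (Fin n)) {R η δ : ℝ} (hη : 0 < η) (hδ : 0 < δ)
    (hR : closedBall x R ⊆ Ω) :
    ∃ g : EuclideanSpace ℝ (Fin n) → EuclideanSpace ℝ (Fin n), ContDiff ℝ 1 g ∧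
      (∀ y ∈ closedBall x (R - η), dist (g y) (f y) ≤ δ) ∧
      ∀ r, ∫⁻ y in closedAnnulus x (r + η) (R - η), ‖fderiv ℝ g y‖ₑ ^ p
        ≤ ∫⁻ y in closedAnnulus x r R, ‖Df y‖ₑ ^ p := by
  have hp0 : 0 < p := by linarith
  set K := closedBall x R with hK
  have hKm : MeasurableSet K := measurableSet_closedBall
  have hKc : IsCompact K := isCompact_closedBall x R
  have hfK : IntegrableOn f K := (hf.mono hR).integrableOn_compact hKc
  have hDfK : IntegrableOn Df K := hS.locallyIntegrableOn_deriv.integrableOn_compact_subset hR hKc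
  obtain ⟨ε₀, hε₀, huc⟩ := Metric.uniformContinuousOn_iff.1
    (hKc.uniformContinuousOn_of_continuous (hf.mono hR)) δ hδ
  set ε := min ε₀ η with hε
  have hε0 : 0 < ε := lt_min hε₀ hη
  have hεη : ε ≤ η := min_le_right _ _
  let φ : ContDiffBump (0 : EuclideanSpace ℝ (Fin n)) := ⟨ε / 2, ε, by linarith, by linarith⟩
  set ψ := φ.normed volume with hψ
  have hψC : ContDiff ℝ ∞ ψ := φ.contDiff_normed
  have hsupp : Function.support ψ = ball 0 ε := φ.support_normed_eq
  have hψ0 : ∀ w, 0 ≤ ψ w := φ.nonneg_normed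
  have hψi : Integrable ψ := φ.integrable_normed
  have hψ1 : ∫⁻ w, ‖ψ w‖ₑ = 1 := by
    have h1 : ∫⁻ w, ‖ψ w‖ₑ = ∫⁻ w, ENNReal.ofReal (ψ w) :=
      lintegral_congr fun w => Real.enorm_of_nonneg (hψ0 w)
    rw [h1, ← ofReal_integral_eq_lintegral_ofReal hψi (Filter.Eventually.of_forall hψ0),
      φ.integral_normed, ENNReal.ofReal_one]
  have hsub : ∀ y ∈ closedBall x (R - η), closedBall y ε ⊆ K := fun y hy =>
    closedBall_subset_closedBall' (by rw [mem_closedBall] at hy; linarith)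
  set g := convolution ψ (K.indicator f) (ContinuousLinearMap.lsmul ℝ ℝ) volume with hg
  have hind : Integrable (K.indicator f) := (integrable_indicator_iff hKm).2 hfK
  refine ⟨g, ?_, ?_, ?_⟩
  · exact φ.hasCompactSupport_normed.contDiff_convolution_left (n := 1) _
      (hψC.of_le (by exact_mod_cast le_top)) hind.locallyIntegrable
  · intro y hy
    have hyK : y ∈ K := hsub y hy (mem_closedBall_self hε0.le)
    have h := φ.dist_normed_convolution_le (μ := volume) (x₀ := y) (ε := δ)
      hind.aestronglyMeasurable (fun w hw => by
        have hwK : w ∈ K := hsub y hy (ball_subset_closedBall hw)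
        rw [indicator_of_mem hwK, indicator_of_mem hyK]
        exact (huc w hwK y hyK (lt_of_lt_of_le hw (min_le_left _ _))).le)
    rwa [indicator_of_mem hyK] at h
  · intro r
    set A' := closedAnnulus x (r + η) (R - η) with hA'
    set A := closedAnnulus x r R with hA
    set H : EuclideanSpace ℝ (Fin n) → ℝ≥0∞ := K.indicator fun w => ‖Df w‖ₑ with hH
    have hHm : AEMeasurable H volume :=
      (aemeasurable_indicator_iff hKm).2 hDfK.aestronglyMeasurable.enorm
    have hψm : Measurable fun w => ‖ψ w‖ₑ := hψC.continuous.measurable.enorm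
    have jensen : ∀ y ∈ A', ‖fderiv ℝ g y‖ₑ ^ p ≤ ∫⁻ w, ‖ψ (y - w)‖ₑ * H w ^ p := by
      intro y hy
      have hyb : y ∈ closedBall x (R - η) := by
        rw [mem_closedBall, dist_comm]; exact hy.2
      have hm : Measurable fun w => ‖ψ (y - w)‖ₑ := hψm.comp (measurable_const_sub y)
      have hprob : IsProbabilityMeasure (volume.withDensity fun w => ‖ψ (y - w)‖ₑ) := by
        refine ⟨?_⟩
        rw [withDensity_apply _ MeasurableSet.univ, Measure.restrict_univ,
          lintegral_sub_left_eq_self (fun w => ‖ψ w‖ₑ) y, hψ1]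
      have h1 := rpow_lintegral_le_of_isProbabilityMeasure hp
        (hHm.mono_ac (withDensity_absolutelyContinuous volume fun w => ‖ψ (y - w)‖ₑ))
      rw [lintegral_withDensity_eq_lintegral_mul₀ hm.aemeasurable hHm,
        lintegral_withDensity_eq_lintegral_mul₀ hm.aemeasurable (hHm.pow_const p)] at h1
      refine le_trans ?_ h1
      gcongr
      exact enorm_fderiv_convolution_le hS hKm hR hΩ hfK hψC hsupp.subset (hsub y hyb)
    have hjoint : AEMeasurable (Function.uncurry fun y w => ‖ψ (y - w)‖ₑ * H w ^ p)
        ((volume.restrict A').prod volume) :=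
      ((hψm.comp (measurable_fst.sub measurable_snd)).aemeasurable).mul
        ((hHm.pow_const p).comp_snd)
    calc ∫⁻ y in A', ‖fderiv ℝ g y‖ₑ ^ p
        ≤ ∫⁻ y in A', ∫⁻ w, ‖ψ (y - w)‖ₑ * H w ^ p :=
          setLIntegral_mono' (isClosed_closedAnnulus _ _ _).measurableSet jensen
      _ = ∫⁻ w, ∫⁻ y in A', ‖ψ (y - w)‖ₑ * H w ^ p := lintegral_lintegral_swap hjoint
      _ ≤ ∫⁻ w, A.indicator (fun w => ‖Df w‖ₑ ^ p) w := by
          refine lintegral_mono fun w => ?_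
          dsimp only
          have hmw : Measurable fun y => ‖ψ (y - w)‖ₑ := hψm.comp (measurable_id.sub_const w)
          rw [lintegral_mul_const _ hmw]
          by_cases hw : w ∈ A
          · have hwK : w ∈ K := by
              rw [hK, mem_closedBall, dist_comm]; exact hw.2
            rw [indicator_of_mem hw, hH, indicator_of_mem hwK]
            calc _ ≤ (∫⁻ y, ‖ψ (y - w)‖ₑ) * ‖Df w‖ₑ ^ p := by
                  gcongr
                  exact Measure.restrict_le_self
              _ = _ := by
                  rw [lintegral_sub_right_eq_self (fun y => ‖ψ y‖ₑ) w, hψ1, one_mul]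
          · have h0 : ∫⁻ y in A', ‖ψ (y - w)‖ₑ = 0 := by
              refine (setLIntegral_congr_fun (isClosed_closedAnnulus _ _ _).measurableSet
                (g := fun _ => 0) fun y hy => ?_).trans (by simp)
              have : y - w ∉ Function.support ψ := by
                rw [hsupp, mem_ball_zero_iff, not_lt, ← dist_eq_norm]
                by_contra hlt
                push Not at hlt
                apply hw
                have h1 := hy.1
                have h2 := hy.2
                have h3 := dist_triangle x w y
                have h4 := dist_triangle x y w
                rw [dist_comm w y] at h3
                exact ⟨by linarith, by linarith⟩
              simpa using this
            rw [h0, zero_mul]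
            exact zero_le
      _ = ∫⁻ w in A, ‖Df w‖ₑ ^ p := lintegral_indicator (isClosed_closedAnnulus _ _ _).measurableSet _

end Mollification

/-! ### The oscillation of monotone maps -/

section Monotone

/-- A monotone function takes on every sphere values at least as large, and values at least as
small, as at any given points inside. -/
theorem IsMonotoneInBalls.exists_norm_eq {n : ℕ} [NeZero n] {Ω : Set (EuclideanSpace ℝ (Fin n))}
    {u : EuclideanSpace ℝ (Fin n) → ℝ} (hu : IsMonotoneInBalls Ω u) (huc : ContinuousOn u Ω)
    {x : EuclideanSpace ℝ (Fin n)} {t : ℝ} (ht : 0 < t) (hΩ : closedBall x t ⊆ Ω)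
    {y y' : EuclideanSpace ℝ (Fin n)} (hy : y ∈ ball x t) (hy' : y' ∈ ball x t) :
    ∃ a b : EuclideanSpace ℝ (Fin n), ‖a‖ = t ∧ ‖b‖ = t ∧ u y ≤ u (x + a) ∧ u (x + b) ≤ u y' := by
  have hne : (sphere x t).Nonempty := NormedSpace.sphere_nonempty.2 ht.le
  have hcs : ContinuousOn u (sphere x t) := huc.mono (sphere_subset_closedBall.trans hΩ)
  obtain ⟨a, ha, hamax⟩ := (isCompact_sphere x t).exists_isMaxOn hne hcs
  obtain ⟨b, hb, hbmin⟩ := (isCompact_sphere x t).exists_isMinOn hne hcs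
  obtain ⟨hsup, hinf⟩ := hu x t ht hΩ
  refine ⟨a - x, b - x, mem_sphere_iff_norm.1 ha, mem_sphere_iff_norm.1 hb, ?_, ?_⟩
  · rw [add_sub_cancel, ← EReal.coe_le_coe_iff]
    calc (u y : EReal) ≤ ⨆ z ∈ ball x t, (u z : EReal) :=
          le_iSup₂ (f := fun z (_ : z ∈ ball x t) => (u z : EReal)) y hy
      _ = ⨆ z ∈ sphere x t, (u z : EReal) := hsup.symm
      _ ≤ u a := iSup₂_le fun z hz => EReal.coe_le_coe_iff.2 (hamax hz)
  · rw [add_sub_cancel, ← EReal.coe_le_coe_iff]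
    calc (u b : EReal) ≤ ⨅ z ∈ sphere x t, (u z : EReal) :=
          le_iInf₂ fun z hz => EReal.coe_le_coe_iff.2 (hbmin hz)
      _ = ⨅ z ∈ ball x t, (u z : EReal) := hinf
      _ ≤ u y' := iInf₂_le (f := fun z (_ : z ∈ ball x t) => (u z : EReal)) y' hy'

theorem EuclideanSpace.enorm_le_sum {n : ℕ} (v : EuclideanSpace ℝ (Fin n)) :
    ‖v‖ₑ ≤ ∑ i, ‖v i‖ₑ := by
  have h : ‖v‖ ≤ ∑ i, ‖v i‖ := by
    rw [EuclideanSpace.norm_eq]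
    exact Real.sqrt_le_iff.2 ⟨Finset.sum_nonneg fun i _ => norm_nonneg _,
      Finset.sum_sq_le_sq_sum_of_nonneg fun i _ => norm_nonneg _⟩
  calc ‖v‖ₑ = ENNReal.ofReal ‖v‖ := (ofReal_norm v).symm
    _ ≤ ENNReal.ofReal (∑ i, ‖v i‖) := ENNReal.ofReal_le_ofReal h
    _ = ∑ i, ‖v i‖ₑ := by
      rw [ENNReal.ofReal_sum_of_nonneg fun i _ => norm_nonneg _]
      simp only [ofReal_norm]

/-- If the oscillation of a smooth map is at least `M` on all spheres of radius close to `3 r / 2`,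
then `M` is controlled by the energy in an annulus: the Sobolev embedding on spheres is integrated
over the radius. -/
theorem exists_ofReal_le_of_oscillation {m : ℕ} (hm : 1 ≤ m) {p : ℝ} (hmp : (m : ℝ) < p) :
    ∃ C : ℝ, 0 < C ∧ ∀ {g : EuclideanSpace ℝ (Fin (m + 1)) → EuclideanSpace ℝ (Fin (m + 1))}
      (_ : ContDiff ℝ 1 g) (x : EuclideanSpace ℝ (Fin (m + 1))) {r M : ℝ} (_ : 0 < r)
      (_ : ∀ t ∈ Ioo (r + r / 4) (2 * r - r / 4), ∃ a b : EuclideanSpace ℝ (Fin (m + 1)),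
        ‖a‖ = t ∧ ‖b‖ = t ∧ M ≤ ‖g (x + a) - g (x + b)‖),
      ENNReal.ofReal M ≤ ENNReal.ofReal (C * r ^ (1 - ((m + 1 : ℕ) : ℝ) / p)) *
        (∫⁻ y in closedAnnulus x (r + r / 4) (2 * r - r / 4), ‖fderiv ℝ g y‖ₑ ^ p) ^ (1 / p) := by
  have hp0 : 0 < p := lt_of_le_of_lt (Nat.cast_nonneg m) hmp
  obtain ⟨C₀, hC₀, H⟩ := exists_enorm_sub_le_on_sphere hm hmp
  set B : ℝ := √(m + 1) with hB
  have hB0 : 0 < B := by positivity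
  set κ : ℝ := 2 * (2 * (m + 1) * (B * (5 / 4 / B) ^ (-(m : ℝ)))) with hκ
  have hκ0 : 0 < κ := by positivity
  refine ⟨C₀ * 2 * κ ^ (1 / p), by positivity, ?_⟩
  intro g hg x r M hr hM
  set I := ∫⁻ y in closedAnnulus x (r + r / 4) (2 * r - r / 4), ‖fderiv ℝ g y‖ₑ ^ p with hI
  set J := faceLIntegral (fun w => ‖fderiv ℝ g w‖ₑ ^ p) x with hJ
  have hFm : Measurable fun w => ‖fderiv ℝ g w‖ₑ ^ p :=
    (hg.continuous_fderiv one_ne_zero).measurable.enorm.pow_const p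
  have pointwise : ∀ t ∈ Ioo (r + r / 4) (2 * r - r / 4),
      ENNReal.ofReal M ^ p ≤ ENNReal.ofReal ((C₀ * (2 * r)) ^ p) * J t := by
    intro t ht
    obtain ⟨a, b, ha, hb, hab⟩ := hM t ht
    have ht0 : 0 < t := by linarith [ht.1]
    have h1 : ENNReal.ofReal M ≤ ENNReal.ofReal (C₀ * (2 * r)) * J t ^ (1 / p) := by
      calc ENNReal.ofReal M ≤ ‖g (x + a) - g (x + b)‖ₑ := by
            rw [← ofReal_norm]; exact ENNReal.ofReal_le_ofReal hab
        _ ≤ ENNReal.ofReal (C₀ * t) * J t ^ (1 / p) := H hg x ht0 ha hb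
        _ ≤ _ := by
            gcongr
            linarith [ht.2]
    calc ENNReal.ofReal M ^ p ≤ (ENNReal.ofReal (C₀ * (2 * r)) * J t ^ (1 / p)) ^ p := by gcongr
      _ = _ := by
        rw [ENNReal.mul_rpow_of_nonneg _ _ hp0.le, ← ENNReal.rpow_mul,
          one_div_mul_cancel hp0.ne', ENNReal.rpow_one,
          ENNReal.ofReal_rpow_of_nonneg (by positivity) hp0.le]
  have integrated : ENNReal.ofReal (r / 2) * ENNReal.ofReal M ^ p
      ≤ ENNReal.ofReal ((C₀ * (2 * r)) ^ p *
          (2 * (m + 1) * (B * ((r + r / 4) / B) ^ (-(m : ℝ))))) * I := by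
    calc ENNReal.ofReal (r / 2) * ENNReal.ofReal M ^ p
        = ∫⁻ _ in Ioo (r + r / 4) (2 * r - r / 4), ENNReal.ofReal M ^ p := by
          rw [setLIntegral_const, Real.volume_Ioo, mul_comm]
          congr 2
          ring
      _ ≤ ∫⁻ t in Ioo (r + r / 4) (2 * r - r / 4), ENNReal.ofReal ((C₀ * (2 * r)) ^ p) * J t :=
          setLIntegral_mono' measurableSet_Ioo pointwise
      _ = ENNReal.ofReal ((C₀ * (2 * r)) ^ p) * ∫⁻ t in Ioo (r + r / 4) (2 * r - r / 4), J t :=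
          lintegral_const_mul' _ _ ENNReal.ofReal_ne_top
      _ ≤ _ := by
          rw [ENNReal.ofReal_mul (by positivity), mul_assoc]
          gcongr
          exact lintegral_faceLIntegral_le x hFm (by positivity)
  -- The powers of `r` combine to `r ^ (-1) * r ^ p * r ^ (-m)`, with exponent `p - (m + 1)`.
  have hconst : (r / 2)⁻¹ * ((C₀ * (2 * r)) ^ p *
        (2 * (m + 1) * (B * ((r + r / 4) / B) ^ (-(m : ℝ)))))
      = (C₀ * 2 * κ ^ (1 / p) * r ^ (1 - ((m + 1 : ℕ) : ℝ) / p)) ^ p := by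
    have e1 : (r + r / 4) / B = 5 / 4 / B * r := by ring
    have e2 : (1 - ((m + 1 : ℕ) : ℝ) / p) * p = p + -(m : ℝ) + (-1) := by
      push_cast
      field_simp
      ring
    have e3 : C₀ * (2 * r) = C₀ * 2 * r := by ring
    have e4 : (C₀ * 2 * κ ^ (1 / p)) ^ p = (C₀ * 2) ^ p * κ := by
      rw [Real.mul_rpow (by positivity) (by positivity), ← Real.rpow_mul hκ0.le,
        one_div_mul_cancel hp0.ne', Real.rpow_one]
    rw [Real.mul_rpow (by positivity) (Real.rpow_nonneg hr.le _), e4, ← Real.rpow_mul hr.le, e1, e3,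
      Real.mul_rpow (by positivity) hr.le, Real.mul_rpow (by positivity) hr.le, e2, Real.rpow_add hr, Real.rpow_add hr, Real.rpow_neg_one, hκ]
    field_simp
  have hr2 : ENNReal.ofReal (r / 2) ≠ 0 := by simpa using hr
  have final : ENNReal.ofReal M ^ p ≤ ENNReal.ofReal
      ((C₀ * 2 * κ ^ (1 / p) * r ^ (1 - ((m + 1 : ℕ) : ℝ) / p)) ^ p) * I := by
    rw [← hconst, ENNReal.ofReal_mul (by positivity), mul_assoc,
      ENNReal.ofReal_inv_of_pos (by positivity),
      ← ENNReal.mul_le_iff_le_inv hr2 ENNReal.ofReal_ne_top]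
    exact integrated
  calc ENNReal.ofReal M = (ENNReal.ofReal M ^ p) ^ (1 / p) := by
        rw [← ENNReal.rpow_mul, mul_one_div_cancel hp0.ne', ENNReal.rpow_one]
    _ ≤ (ENNReal.ofReal
      ((C₀ * 2 * κ ^ (1 / p) * r ^ (1 - ((m + 1 : ℕ) : ℝ) / p)) ^ p) * I) ^ (1 / p) := by gcongr
    _ = _ := by
        rw [ENNReal.mul_rpow_of_nonneg _ _ (by positivity),
          ENNReal.ofReal_rpow_of_nonneg (by positivity) (by positivity), ← Real.rpow_mul
            (by positivity), mul_one_div_cancel hp0.ne', Real.rpow_one]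

end Monotone

theorem lemma4p1 (n : ℕ) (hn : 2 ≤ n) (p : ℝ) (hp₁ : (n : ℝ) - 1 < p) (hp₂ : p < n) :
    ∃ C : ℝ, 0 < C ∧
      ∀ (Ω : Set (EuclideanSpace ℝ (Fin n)))
        (f : EuclideanSpace ℝ (Fin n) → EuclideanSpace ℝ (Fin n))
        (Df : EuclideanSpace ℝ (Fin n) →
          EuclideanSpace ℝ (Fin n) →L[ℝ] EuclideanSpace ℝ (Fin n)),
        IsOpen Ω → IsConnected Ω →
        ContinuousOn f Ω →
        (∀ i : Fin n, IsMonotoneInBalls Ω (fun y => f y i)) →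
        IsSobolevLocOn Ω p f Df →
        ∀ (x : EuclideanSpace ℝ (Fin n)) (r : ℝ), 0 < r → closedBall x (2 * r) ⊆ Ω →
          ediam (f '' ball x r) ≤
            ENNReal.ofReal (C * r ^ (1 - (n : ℝ) / p)) *
              (∫⁻ y in closedAnnulus x r (2 * r), ‖Df y‖ₑ ^ p) ^ (1 / p) := by
  obtain ⟨m, rfl⟩ : ∃ m, n = m + 1 := ⟨n - 1, by omega⟩
  have hm : 1 ≤ m := by omega
  have hmp : (m : ℝ) < p := by push_cast at hp₁; linarith
  have hp : 1 ≤ p := by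
    have : (1 : ℝ) ≤ m := by exact_mod_cast hm
    linarith
  obtain ⟨C, hC, H⟩ := exists_ofReal_le_of_oscillation hm hmp
  refine ⟨(m + 1) * C, by positivity, ?_⟩
  intro Ω f Df hΩ _ hf hmono hS x r hr hball
  have hfi : ∀ i, ContinuousOn (fun y => f y i) Ω := fun i =>
    (EuclideanSpace.proj (𝕜 := ℝ) i).continuous.comp_continuousOn hf
  set T : ℝ≥0∞ := ENNReal.ofReal (C * r ^ (1 - ((m + 1 : ℕ) : ℝ) / p)) *
    (∫⁻ y in closedAnnulus x r (2 * r), ‖Df y‖ₑ ^ p) ^ (1 / p) with hT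
  have component : ∀ i, ∀ y ∈ ball x r, ∀ y' ∈ ball x r, ENNReal.ofReal (f y i - f y' i) ≤ T := by
    intro i y hy y' hy'
    -- Replacing `f` by a mollification `g` within `δ / 2` of it lowers the oscillation by at most `δ`.
    refine ENNReal.le_of_forall_pos_le_add fun δ hδ _ => ?_
    obtain ⟨g, hgC, hgf, hgE⟩ := exists_contDiff_approx hp hS.hasWeakFDerivOn hΩ.measurableSet hf
      x (η := r / 4) (δ := δ / 2) (by positivity) (by positivity) hball
    have hosc : ∀ t ∈ Ioo (r + r / 4) (2 * r - r / 4),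
        ∃ a b : EuclideanSpace ℝ (Fin (m + 1)), ‖a‖ = t ∧ ‖b‖ = t ∧
          f y i - f y' i - δ ≤ ‖g (x + a) - g (x + b)‖ := by
      intro t ht
      obtain ⟨a, b, ha, hb, hya, hyb⟩ := (hmono i).exists_norm_eq (t := t) (hfi i) (by linarith [ht.1])
        ((closedBall_subset_closedBall (by linarith [ht.2])).trans hball)
        (ball_subset_ball (by linarith [ht.1]) hy) (ball_subset_ball (by linarith [ht.1]) hy')
      refine ⟨a, b, ha, hb, ?_⟩
      have hclose : ∀ c : EuclideanSpace ℝ (Fin (m + 1)), ‖c‖ = t →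
          |g (x + c) i - f (x + c) i| ≤ δ / 2 := by
        intro c hc
        have h1 := hgf (x + c) (by
          rw [mem_closedBall, dist_self_add_left, hc]
          exact ht.2.le)
        rw [dist_eq_norm] at h1
        exact (PiLp.norm_apply_le (g (x + c) - f (x + c)) i).trans h1
      have h1 := (abs_le.1 (hclose a ha)).1
      have h2 := (abs_le.1 (hclose b hb)).2
      have h3 := (le_abs_self _).trans (PiLp.norm_apply_le (g (x + a) - g (x + b)) i)
      rw [PiLp.sub_apply] at h3
      linarith
    calc ENNReal.ofReal (f y i - f y' i)
        ≤ ENNReal.ofReal (f y i - f y' i - δ) + ENNReal.ofReal δ := by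
          refine le_trans (le_of_eq ?_) ENNReal.ofReal_add_le
          rw [sub_add_cancel]
      _ ≤ T + δ := by
          rw [ENNReal.ofReal_coe_nnreal]
          gcongr
          refine (H hgC x hr hosc).trans ?_
          rw [hT]
          gcongr _ * ?_ ^ _
          exact hgE r
  refine ediam_le fun z hz z' hz' => ?_
  obtain ⟨y, hy, rfl⟩ := hz
  obtain ⟨y', hy', rfl⟩ := hz'
  calc edist (f y) (f y') = ‖f y - f y'‖ₑ := edist_eq_enorm_sub _ _
    _ ≤ ∑ i, ‖(f y - f y') i‖ₑ := EuclideanSpace.enorm_le_sum _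
    _ ≤ ∑ _i : Fin (m + 1), T := by
        refine Finset.sum_le_sum fun i _ => ?_
        rw [PiLp.sub_apply, ← ofReal_norm, Real.norm_eq_abs]
        rcases abs_cases (f y i - f y' i) with ⟨h, -⟩ | ⟨h, -⟩
        · rw [h]; exact component i y hy y' hy'
        · rw [h, neg_sub]; exact component i y' hy' y hy
    _ = _ := by
        rw [Finset.sum_const, Finset.card_univ, Fintype.card_fin, nsmul_eq_mul, hT, ← mul_assoc,
          mul_assoc ((m : ℝ) + 1) C, ENNReal.ofReal_mul (by positivity : (0 : ℝ) ≤ (m : ℝ) + 1),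
          ← ENNReal.ofReal_natCast]
        push_cast
        rfl
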